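/- Let $(X,d)$ be a compact metric space and let $f_{0,\infty}=\{f_n\}_{n\ge 0}$ be a sequence of continuous maps $f_n:X\to X$ that is equicontinuous. For a sequence $g_{0,\infty}=\{g_n\}_{n\ge0}$ of self-maps of a metric space $(Y,\rho)$ put $g_0^0=\mathrm{id}$ and $g_0^n=g_{n-1}\circ\cdots\circ g_0$. A set $E\subset Y$ is $(n,\varepsilon)$-separated if for all $x\ne y$ in $E$ there is $0\le k\le n-1$ with $\rho(g_0^k(x),g_0^k(y))>\varepsilon$. Let $s_n(\varepsilon)$ be the maximal cardinality of an $(n,\varepsilon)$-separated subset of $Y$. The topological entropy of $(Y,g_{0,\infty})$ is $$h(g_{0,\infty})=\lim_{\varepsilon\to0}\limsup_{n\to\infty}\frac1n\log s_n(\varepsilon).$$ Let $\mathcal K(X)$ be the space of nonempty compact subsets of $X$ with the Hausdorff metric, and let $\bar f_n(A)=f_n(A)$ for $A\in\mathcal K(X)$. Let $\mathcal F(X)$ be the set of all upper semicontinuous functions $u:X\to I=[0,1]$ (including $u\equiv0$), with the endograph metric $d_E(u,v)=D_{X\times I}(\mathrm{end}(u),\mathrm{end}(v))$, where $\mathrm{end}(u)=\{(x,a)\in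 X\times I: u(x)\ge a\}$ and $D_{X\times I}$ is the Hausdorff metric for the maximum metric on $X\times I$. Let $\tilde f_n:\mathcal F(X)\to\mathcal F(X)$ be the Zadeh extension of $f_n$: $\tilde f_n(u)(x)=\sup_{z\in f_n^{-1}(x)}u(z)$ if $f_n^{-1}(x)\ne\emptyset$, and $\tilde f_n(u)(x)=0$ otherwise. If $h(f_{0,\infty})>0$, then $$h(\tilde f_{0,\infty})=h(\bar f_{0,\infty})=+\infty .$$ -/

import Mathlib

open Set Filter Topology TopologicalSpace
open scoped unitInterval

noncomputable section

namespace NDS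

/-! ## Topological entropy of a non-autonomous system -/

/-- The iterate `f_0^n = f_{n-1} ∘ ⋯ ∘ f_0` of a sequence of self-maps, with `f_0^0 = id`. -/
def orbitMap {Y : Type*} (f : ℕ → Y → Y) : ℕ → Y → Y
  | 0 => id
  | n + 1 => f n ∘ orbitMap f n

/-- `E` is `(n, ε)`-separated: any two distinct points of `E` are more than `ε` apart at some
time `0 ≤ k ≤ n - 1`. -/
def IsSeparated {Y : Type*} [MetricSpace Y] (f : ℕ → Y → Y) (n : ℕ) (ε : ℝ) (E : Set Y) : Prop :=
  ∀ x ∈ E, ∀ y ∈ E, x ≠ y → ∃ k < n, ε < dist (orbitMap f k x) (orbitMap f k y)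

/-- The maximal cardinality `s_n(ε)` of an `(n, ε)`-separated subset of `Y`. -/
def maxSep {Y : Type*} [MetricSpace Y] (f : ℕ → Y → Y) (n : ℕ) (ε : ℝ) : ℕ∞ :=
  ⨆ (E : Set Y) (_ : IsSeparated f n ε E), E.encard

/-- The topological entropy `lim_{ε → 0} limsup_n (1/n) log s_n(ε)`. Since `s_n(ε)` increases as
`ε` decreases, the limit is a supremum over `ε > 0`. -/
def entropy {Y : Type*} [MetricSpace Y] (f : ℕ → Y → Y) : EReal :=
  ⨆ (ε : ℝ) (_ : 0 < ε),
    limsup (fun n : ℕ => ENNReal.log (maxSep f n ε : ENNReal) / (n : EReal)) atTop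

/-! ## The hyperspace system -/

/-- The map `A ↦ f(A)` on the space of nonempty compact subsets (which in Mathlib carries the
Hausdorff metric). -/
def hyperMap {X : Type*} [TopologicalSpace X] (f : C(X, X)) :
    NonemptyCompacts X → NonemptyCompacts X :=
  NonemptyCompacts.map f f.continuous

/-! ## The fuzzified system -/

/-- The upper semicontinuous fuzzy sets `u : X → [0, 1]`; the empty fuzzy set is included. -/
@[ext]
structure FuzzySet (X : Type*) [TopologicalSpace X] where
  toFun : X → I
  usc : UpperSemicontinuous toFun

/-- The endograph `{(x, a) ∈ X × [0, 1] : a ≤ u x}`. -/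
def FuzzySet.endograph {X : Type*} [TopologicalSpace X] (u : FuzzySet X) : Set (X × I) :=
  {p | p.2 ≤ u.toFun p.1}

/-- The Zadeh extension of `f` at `u`, as a function. -/
def zadehFun {X : Type*} (f : X → X) (u : X → I) (x : X) : I :=
  open Classical in
  if (f ⁻¹' {x}).Nonempty then sSup (u '' (f ⁻¹' {x})) else 0

lemma FuzzySet.isClosed_endograph {X : Type*} [TopologicalSpace X] (u : FuzzySet X) :
    IsClosed u.endograph :=
  upperSemicontinuous_iff_IsClosed_hypograph.1 u.usc

lemma FuzzySet.endograph_injective {X : Type*} [TopologicalSpace X] :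
    Function.Injective (FuzzySet.endograph : FuzzySet X → Set (X × I)) := by
  intro u v h
  have key : ∀ (x : X) (a : I), a ≤ u.toFun x ↔ a ≤ v.toFun x := fun x a => by
    have := Set.ext_iff.1 h (x, a)
    simpa [FuzzySet.endograph] using this
  ext1
  funext x
  exact le_antisymm ((key x _).1 le_rfl) ((key x _).2 le_rfl)

lemma FuzzySet.hausdorffEDist_ne_top {X : Type*} [MetricSpace X] [CompactSpace X]
    (u v : FuzzySet X) : Metric.hausdorffEDist u.endograph v.endograph ≠ ⊤ := by
  rcases isEmpty_or_nonempty X with hX | ⟨⟨x⟩⟩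
  · have h : u.endograph = v.endograph := by
      ext p
      exact (hX.false p.1).elim
    simp [h, Metric.hausdorffEDist_self]
  · exact Metric.hausdorffEDist_ne_top_of_nonempty_of_bounded ⟨(x, 0), (u.toFun x).2.1⟩ ⟨(x, 0), (v.toFun x).2.1⟩
      (Metric.isBounded_of_compactSpace) (Metric.isBounded_of_compactSpace)

/-- The endograph metric: the Hausdorff distance of the endographs in `X × [0, 1]`, where the
product carries the maximum metric. For the empty fuzzy set, see
`FuzzySet.hausdorffDist_restrict_support`. -/
instance FuzzySet.instMetricSpace {X : Type*} [MetricSpace X] [CompactSpace X] :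
    MetricSpace (FuzzySet X) where
  dist u v := Metric.hausdorffDist u.endograph v.endograph
  dist_self _ := Metric.hausdorffDist_self_zero
  dist_comm _ _ := Metric.hausdorffDist_comm
  dist_triangle u v _ := Metric.hausdorffDist_triangle (hausdorffEDist_ne_top u v)
  eq_of_dist_eq_zero {u v} h := endograph_injective
    ((u.isClosed_endograph.hausdorffDist_zero_iff_eq v.isClosed_endograph
      (hausdorffEDist_ne_top u v)).1 h)

lemma FuzzySet.dist_eq {X : Type*} [MetricSpace X] [CompactSpace X] (u v : FuzzySet X) :
    dist u v = Metric.hausdorffDist u.endograph v.endograph := rfl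

/-- The empty fuzzy set. -/
def FuzzySet.empty (X : Type*) [TopologicalSpace X] : FuzzySet X where
  toFun _ := 0
  usc := upperSemicontinuous_const

/-- The support `closure {x | 0 < u x}`. -/
def FuzzySet.support {X : Type*} [TopologicalSpace X] (u : FuzzySet X) : Set X :=
  closure {x | 0 < u.toFun x}

/-- In the distance from `u` to the empty fuzzy set it makes no difference whether the endographs
are compared in `X × [0, 1]` or only over the support of `u`. -/
lemma FuzzySet.hausdorffDist_restrict_support {X : Type*} [MetricSpace X] [CompactSpace X]
    (u : FuzzySet X) :
    Metric.hausdorffDist ((empty X).endograph ∩ u.support ×ˢ univ)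
      (u.endograph ∩ u.support ×ˢ univ) = dist (empty X) u := by
  have hsub : (empty X).endograph ⊆ u.endograph := fun p hp => le_trans hp (u.toFun p.1).2.1
  have hmem : ∀ p ∈ u.endograph, p ∉ u.support ×ˢ (univ : Set I) → p ∈ (empty X).endograph := by
    intro p hp hps
    have h1 : ¬ 0 < u.toFun p.1 := fun h => hps ⟨subset_closure h, mem_univ _⟩
    exact le_trans (show p.2 ≤ u.toFun p.1 from hp) (not_lt.1 h1)
  have hbase : ∀ x, (x, (0 : I)) ∈ (empty X).endograph := fun x => le_refl (0 : I)
  have hlow : ∀ p : X × I, ∀ q ∈ (empty X).endograph, edist p (p.1, (0 : I)) ≤ edist p q := by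
    intro p q hq
    have hq2 : q.2 = 0 := le_antisymm hq bot_le
    simp only [Prod.edist_eq, edist_self, hq2]
    exact max_le bot_le (le_max_right _ _)
  rw [dist_eq, Metric.hausdorffDist, Metric.hausdorffDist]
  congr 1
  apply le_antisymm
  · refine Metric.hausdorffEDist_le_of_mem_edist ?_ ?_
    · rintro p ⟨hp, hps⟩
      exact ⟨p, ⟨hsub hp, hps⟩, by simp⟩
    · rintro p ⟨hp, hps⟩
      refine ⟨(p.1, 0), ⟨hbase _, hps.1, mem_univ _⟩, ?_⟩
      calc edist p (p.1, (0 : I)) ≤ Metric.infEDist p (empty X).endograph :=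
            Metric.le_infEDist.2 (hlow p)
        _ ≤ Metric.hausdorffEDist u.endograph (empty X).endograph :=
            Metric.infEDist_le_hausdorffEDist_of_mem hp
        _ = _ := Metric.hausdorffEDist_comm
  · refine Metric.hausdorffEDist_le_of_mem_edist ?_ ?_
    · intro p hp
      exact ⟨p, hsub hp, by simp⟩
    · intro p hp
      by_cases hps : p ∈ u.support ×ˢ (univ : Set I)
      · refine ⟨(p.1, 0), hbase _, ?_⟩
        calc edist p (p.1, (0 : I))
            ≤ Metric.infEDist p ((empty X).endograph ∩ u.support ×ˢ univ) :=
              Metric.le_infEDist.2 fun q hq => hlow p q hq.1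
          _ ≤ Metric.hausdorffEDist (u.endograph ∩ u.support ×ˢ univ)
                ((empty X).endograph ∩ u.support ×ˢ univ) :=
              Metric.infEDist_le_hausdorffEDist_of_mem ⟨hp, hps⟩
          _ = _ := Metric.hausdorffEDist_comm
      · exact ⟨p, hmem p hp hps, by simp⟩

/-- For `a > 0`, the `a`-level set of the Zadeh extension is the image of that of `u`. -/
lemma le_zadehFun_iff {X : Type*} [MetricSpace X] [CompactSpace X] (f : C(X, X))
    (u : FuzzySet X) {a : I} (ha : 0 < a) (x : X) :
    a ≤ zadehFun f u.toFun x ↔ ∃ z, f z = x ∧ a ≤ u.toFun z := by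
  constructor
  · intro h
    by_cases hne : (f ⁻¹' {x}).Nonempty
    · rw [zadehFun, if_pos hne] at h
      have hc : IsCompact (f ⁻¹' {x}) := (isClosed_singleton.preimage f.continuous).isCompact
      obtain ⟨z, hz, hmax⟩ := (u.usc.upperSemicontinuousOn _).exists_isMaxOn hne hc
      refine ⟨z, hz, h.trans (sSup_le ?_)⟩
      rintro _ ⟨w, hw, rfl⟩
      exact hmax hw
    · rw [zadehFun, if_neg hne] at h
      exact absurd ha (not_lt.2 h)
  · rintro ⟨z, rfl, hz⟩
    have hne : (f ⁻¹' {f z}).Nonempty := ⟨z, rfl⟩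
    rw [zadehFun, if_pos hne]
    exact hz.trans (le_sSup ⟨z, rfl, rfl⟩)

/-- The Zadeh extension of a continuous map, as a self-map of the space of fuzzy sets. -/
def fuzzyMap {X : Type*} [MetricSpace X] [CompactSpace X] (f : C(X, X)) (u : FuzzySet X) :
    FuzzySet X where
  toFun := zadehFun f u.toFun
  usc := by
    rw [upperSemicontinuous_iff_isClosed_preimage]
    intro a
    rcases eq_or_lt_of_le (bot_le : (0 : I) ≤ a) with rfl | ha
    · convert isClosed_univ
      exact eq_univ_of_forall fun x => (bot_le : (0 : I) ≤ _)
    · have h : zadehFun f u.toFun ⁻¹' Ici a = f '' (u.toFun ⁻¹' Ici a) := by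
        ext x
        rw [mem_preimage, mem_Ici, le_zadehFun_iff f u ha]
        simp [and_comm]
      rw [h]
      exact ((u.usc.isClosed_preimage a).isCompact.image f.continuous).isClosed

end NDS

end

open Set Filter Topology TopologicalSpace
open scoped unitInterval

noncomputable section

namespace NDS

/-! ## Separated sets -/

/-! For the hyperspace, fix `k` and count `k`-tuples from an `(n, ε)`-separated set `E` with at
least `exp (h n)` points. A tuple whose value set stays `δ`-close to that of `c` has each entry
follow some entry of `c`. By uniform equicontinuity it suffices to record which one every `m` steps,
so at most `(k ^ (n/m + 1)) ^ k` tuples stay close to `c` (`card_close_families_le`). For `m` large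
compared with `log k / h` this is at most `exp (k h n / 2)`, while there are at least `exp (k h n)`
tuples. A greedy selection (`exists_pairwise_not_card_le`) then leaves at least `exp (k h n / 2)`
separated finite sets. The scale `δ` depends on `k`, which is harmless because entropy is a supremum
over scales; now let `k` grow.

The fuzzified system contains the hyperspace system through characteristic functions, with
separation preserved at scales below 1, so its entropy is infinite too. -/

lemma IsSeparated.encard_le_maxSep {Y : Type*} [MetricSpace Y] {f : ℕ → Y → Y} {n : ℕ} {ε : ℝ}
    {E : Set Y} (hE : IsSeparated f n ε E) : E.encard ≤ maxSep f n ε :=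
  le_iSup₂ (f := fun (E : Set Y) (_ : IsSeparated f n ε E) => E.encard) E hE

lemma exists_finset_isSeparated {Y : Type*} [MetricSpace Y] {f : ℕ → Y → Y} {n N : ℕ} {ε : ℝ}
    (h : (N : ℕ∞) ≤ maxSep f n ε) : ∃ E : Finset Y, IsSeparated f n ε E ∧ E.card = N := by
  obtain ⟨E, hE, hN⟩ : ∃ E : Set Y, IsSeparated f n ε E ∧ (N : ℕ∞) ≤ E.encard := by
    rcases N.eq_zero_or_pos with rfl | hpos
    · exact ⟨∅, by simp [IsSeparated], by simp⟩
    -- The supremum need not be attained if it is infinite; passing to the predecessor gives the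
    -- strict inequality that yields an actual set.
    · obtain ⟨K, rfl⟩ : ∃ K, N = K + 1 := ⟨N - 1, by omega⟩
      have h1 : (K : ℕ∞) < maxSep f n ε :=
        lt_of_lt_of_le (by exact_mod_cast Nat.lt_succ_self K) h
      simp only [maxSep, lt_iSup_iff] at h1
      obtain ⟨E, hE, hK⟩ := h1
      exact ⟨E, hE, by simpa using Order.add_one_le_of_lt hK⟩
  obtain ⟨F, hFE, hF⟩ := exists_subset_encard_eq hN
  have hfin : F.Finite := finite_of_encard_eq_coe hF
  refine ⟨hfin.toFinset, ?_, ?_⟩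
  · rw [hfin.coe_toFinset]
    exact fun x hx y hy => hE x (hFE hx) y (hFE hy)
  · rw [hfin.encard_eq_coe_toFinset_card] at hF
    exact_mod_cast hF

/-- A system embeds into another one if some map conjugates them and preserves separation at
scale `ε`. -/
lemma maxSep_le_of_semiconj {Y Z : Type*} [MetricSpace Y] [MetricSpace Z] {f : ℕ → Y → Y}
    {g : ℕ → Z → Z} (φ : Y → Z) (hφ : ∀ n y, g n (φ y) = φ (f n y)) {ε δ : ℝ} (hδ : 0 ≤ δ)
    (hsep : ∀ x y, ε < dist x y → δ < dist (φ x) (φ y)) (n : ℕ) :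
    maxSep f n ε ≤ maxSep g n δ := by
  have horb : ∀ k y, orbitMap g k (φ y) = φ (orbitMap f k y) := by
    intro k y
    induction k with
    | zero => rfl
    | succ k ih => simp only [orbitMap, Function.comp_apply, ih, hφ]
  refine iSup₂_le fun E hE => ?_
  have hinj : InjOn φ E := by
    intro x hx y hy hxy
    by_contra hne
    obtain ⟨k, -, hk⟩ := hE x hx y hy hne
    have := hsep _ _ hk
    rw [← horb, ← horb, hxy, dist_self] at this
    exact this.not_ge hδ
  rw [← hinj.encard_image]
  apply IsSeparated.encard_le_maxSep
  rintro _ ⟨x, hx, rfl⟩ _ ⟨y, hy, rfl⟩ hne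
  obtain ⟨k, hk, hd⟩ := hE x hx y hy fun h => hne (congrArg φ h)
  exact ⟨k, hk, by simpa only [horb] using hsep _ _ hd⟩

lemma maxSep_anti {Y : Type*} [MetricSpace Y] (f : ℕ → Y → Y) (n : ℕ) {ε δ : ℝ} (h : δ ≤ ε) :
    maxSep f n ε ≤ maxSep f n δ :=
  iSup₂_le fun _ hE => IsSeparated.encard_le_maxSep fun x hx y hy hne =>
    let ⟨k, hk, hd⟩ := hE x hx y hy hne
    ⟨k, hk, h.trans_lt hd⟩

lemma entropy_mono {Y Z : Type*} [MetricSpace Y] [MetricSpace Z] {f : ℕ → Y → Y}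
    {g : ℕ → Z → Z} (h : ∀ ε > 0, ∃ δ > 0, ∀ n, maxSep f n ε ≤ maxSep g n δ) :
    entropy f ≤ entropy g := by
  refine iSup₂_le fun ε hε => ?_
  obtain ⟨δ, hδ, hle⟩ := h ε hε
  refine le_trans (limsup_le_limsup (Eventually.of_forall fun n => ?_)) (le_iSup₂ (f := fun (ε : ℝ) (_ : 0 < ε) =>
    limsup (fun n : ℕ => ENNReal.log (maxSep g n ε : ENNReal) / (n : EReal)) atTop) δ hδ)
  refine EReal.div_le_div_right_of_nonneg (Nat.cast_nonneg' n) ?_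
  exact ENNReal.log_monotone (by exact_mod_cast hle n)

/-! ## Hausdorff distance of compact sets -/

lemma exists_dist_le_of_hausdorffDist_le {Y : Type*} [MetricSpace Y] {s t : Set Y}
    (hs : IsCompact s) (ht : IsCompact t) (htne : t.Nonempty) {δ : ℝ}
    (h : Metric.hausdorffDist s t ≤ δ) {x : Y} (hx : x ∈ s) : ∃ y ∈ t, dist x y ≤ δ := by
  obtain ⟨y, hy, hxy⟩ := ht.exists_infDist_eq_dist htne x
  refine ⟨y, hy, hxy ▸ le_trans (Metric.infDist_le_hausdorffDist_of_mem hx ?_) h⟩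
  exact Metric.hausdorffEDist_ne_top_of_nonempty_of_bounded ⟨x, hx⟩ htne hs.isBounded ht.isBounded

/-! ## The hyperspace system inside the fuzzified system -/

/-- The characteristic function of a compact set as a fuzzy set. -/
def FuzzySet.indicator {X : Type*} [TopologicalSpace X] [T2Space X] (A : NonemptyCompacts X) :
    FuzzySet X where
  toFun := (A : Set X).indicator fun _ => 1
  usc := A.isCompact.isClosed.upperSemicontinuous_indicator zero_le_one

lemma FuzzySet.le_indicator_iff {X : Type*} [TopologicalSpace X] [T2Space X]
    (A : NonemptyCompacts X) {a : I} (ha : 0 < a) (x : X) :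
    a ≤ (indicator A).toFun x ↔ x ∈ A := by
  by_cases hx : x ∈ (A : Set X)
  · simp only [indicator, indicator_of_mem hx]
    exact ⟨fun _ => hx, fun _ => a.2.2⟩
  · simp only [indicator, indicator_of_notMem hx]
    exact ⟨fun h => absurd ha h.not_gt, fun h => absurd h hx⟩

lemma fuzzyMap_indicator {X : Type*} [MetricSpace X] [CompactSpace X] (f : C(X, X))
    (A : NonemptyCompacts X) :
    fuzzyMap f (FuzzySet.indicator A) = FuzzySet.indicator (hyperMap f A) := by
  ext1
  funext x
  refine eq_of_forall_le_iff fun a => ?_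
  rcases eq_or_lt_of_le (bot_le : (0 : I) ≤ a) with rfl | ha
  · exact iff_of_true bot_le bot_le
  · rw [FuzzySet.le_indicator_iff _ ha]
    refine (le_zadehFun_iff f _ ha x).trans ?_
    simp only [FuzzySet.le_indicator_iff _ ha]
    rw [← SetLike.mem_coe, hyperMap, NonemptyCompacts.coe_map]
    simp [and_comm]

lemma FuzzySet.isCompact_endograph {X : Type*} [MetricSpace X] [CompactSpace X]
    (u : FuzzySet X) : IsCompact u.endograph :=
  u.isClosed_endograph.isCompact

/-- A point at height 1 over `A` cannot be matched within `δ < 1` by a point at height 0, and at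
positive height the endograph of `indicator B` lies over `B`. -/
lemma FuzzySet.exists_dist_le_of_dist_indicator_le {X : Type*} [MetricSpace X] [CompactSpace X]
    {A B : NonemptyCompacts X} {δ : ℝ} (hδ : δ < 1)
    (h : dist (indicator A) (indicator B) ≤ δ) {x : X} (hx : x ∈ A) : ∃ y ∈ B, dist x y ≤ δ := by
  have hmem : (x, (1 : I)) ∈ (indicator A).endograph := (le_indicator_iff A zero_lt_one x).2 hx
  obtain ⟨⟨y, t⟩, hyt, hd⟩ := exists_dist_le_of_hausdorffDist_le (isCompact_endograph _)
    (isCompact_endograph (indicator B)) ⟨(x, 0), ((indicator B).toFun x).2.1⟩ h hmem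
  rw [Prod.dist_eq, max_le_iff] at hd
  refine ⟨y, (le_indicator_iff B (a := t) ?_ y).1 hyt, hd.1⟩
  by_contra ht
  have ht0 : t = 0 := le_antisymm (not_lt.1 ht) bot_le
  have := hd.2
  simp only [ht0, Subtype.dist_eq, Real.dist_eq] at this
  norm_num at this
  linarith

lemma FuzzySet.lt_dist_indicator {X : Type*} [MetricSpace X] [CompactSpace X]
    {A B : NonemptyCompacts X} {δ : ℝ} (hδ0 : 0 ≤ δ) (hδ : δ < 1) (h : δ < dist A B) :
    δ < dist (indicator A) (indicator B) := by
  by_contra! hle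
  refine h.not_ge ?_
  rw [Metric.NonemptyCompacts.dist_eq]
  refine Metric.hausdorffDist_le_of_mem_dist hδ0 ?_ ?_
  · exact fun x hx => exists_dist_le_of_dist_indicator_le hδ hle hx
  · exact fun x hx => exists_dist_le_of_dist_indicator_le hδ (dist_comm _ (indicator A) ▸ hle) hx

lemma entropy_hyperMap_le_entropy_fuzzyMap {X : Type*} [MetricSpace X] [CompactSpace X]
    (f : ℕ → C(X, X)) :
    entropy (fun n => hyperMap (f n)) ≤ entropy (fun n => fuzzyMap (f n)) := by
  refine entropy_mono fun ε hε => ?_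
  -- Any cap below 1 would do: characteristic functions preserve separation only at scales less than
  -- 1.
  have hpos : 0 < min ε (1 / 2) := by positivity
  refine ⟨min ε (1 / 2), hpos, fun n => ?_⟩
  refine (maxSep_anti _ n (min_le_left ε (1 / 2))).trans ?_
  refine maxSep_le_of_semiconj FuzzySet.indicator (fun n => fuzzyMap_indicator (f n)) hpos.le ?_ n
  exact fun A B => FuzzySet.lt_dist_indicator hpos.le
    ((min_le_right _ _).trans_lt (by norm_num))

/-! ## Finite sets in the hyperspace system -/

/-- One `δ` serves every starting time `s` because the modulus of continuity is shared by all the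
maps; only the number of steps `m` matters. -/
lemma exists_forall_dist_orbitMap_le {X : Type*} [MetricSpace X] {f : ℕ → X → X}
    (hf : UniformEquicontinuous f) (m : ℕ) {ε : ℝ} (hε : 0 < ε) :
    ∃ δ > 0, ∀ s, ∀ t ≤ m, ∀ x y, dist (orbitMap f s x) (orbitMap f s y) ≤ δ →
      dist (orbitMap f (s + t) x) (orbitMap f (s + t) y) ≤ ε := by
  induction m generalizing ε with
  | zero =>
    refine ⟨ε, hε, fun s t ht x y h => ?_⟩
    obtain rfl : t = 0 := by omega
    exact h
  | succ m ih =>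
    obtain ⟨η, hη, hfη⟩ := Metric.uniformEquicontinuous_iff.1 hf ε hε
    -- `ε` covers the times up to `m`; `η / 2`, strictly below `η`, feeds the last map.
    obtain ⟨δ, hδ, h⟩ := ih (ε := min ε (η / 2)) (by positivity)
    refine ⟨δ, hδ, fun s t ht x y hxy => ?_⟩
    rcases Nat.le_succ_iff.1 ht with ht | rfl
    · exact (h s t ht x y hxy).trans (min_le_left _ _)
    · have := (h s m le_rfl x y hxy).trans (min_le_right _ _)
      exact (hfη _ _ (this.trans_lt (half_lt_self hη)) (s + m)).le

/-- The set of values of a finite family. -/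
def finiteCompacts {X : Type*} [TopologicalSpace X] {ι : Type*} [Finite ι] [Nonempty ι]
    (c : ι → X) : NonemptyCompacts X :=
  ⟨⟨range c, (finite_range c).isCompact⟩, range_nonempty c⟩

lemma orbitMap_hyperMap_finiteCompacts {X : Type*} [TopologicalSpace X] {ι : Type*} [Finite ι]
    [Nonempty ι] (f : ℕ → C(X, X)) (c : ι → X) (j : ℕ) :
    orbitMap (fun n => hyperMap (f n)) j (finiteCompacts c) =
      finiteCompacts fun i => orbitMap (fun n => ⇑(f n)) j (c i) := by
  induction j with
  | zero => rfl
  | succ j ih =>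
    simp only [orbitMap, Function.comp_apply, ih]
    apply SetLike.coe_injective
    rw [hyperMap, NonemptyCompacts.coe_map]
    exact (range_comp _ _).symm

lemma exists_dist_le_of_dist_finiteCompacts_le {X : Type*} [MetricSpace X] {ι : Type*} [Finite ι]
    [Nonempty ι] {c d : ι → X} {δ : ℝ} (h : dist (finiteCompacts c) (finiteCompacts d) ≤ δ)
    (i : ι) : ∃ a, dist (c i) (d a) ≤ δ := by
  obtain ⟨_, ⟨a, rfl⟩, ha⟩ := exists_dist_le_of_hausdorffDist_le (finiteCompacts c).isCompact
    (finiteCompacts d).isCompact (finiteCompacts d).nonempty h ⟨i, rfl⟩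
  exact ⟨a, ha⟩

/-- A finite set in which each point is related to at most `N` points contains a set of pairwise
unrelated points which is smaller by a factor of at most `N`. -/
lemma exists_pairwise_not_card_le {α : Type*} (T : Finset α) (R : α → α → Prop)
    (hrefl : ∀ a, R a a) (hsymm : ∀ a b, R a b → R b a) (N : ℕ)
    (hN : ∀ a ∈ T, ∀ B ⊆ T, (∀ b ∈ B, R b a) → B.card ≤ N) :
    ∃ S ⊆ T, (∀ a ∈ S, ∀ b ∈ S, a ≠ b → ¬ R a b) ∧ T.card ≤ S.card * N := by
  classical
  let P : Set (Finset α) := {S | S ⊆ T ∧ ∀ a ∈ S, ∀ b ∈ S, a ≠ b → ¬ R a b}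
  have hP : P.Finite := T.powerset.finite_toSet.subset fun S hS => Finset.mem_powerset.2 hS.1
  -- By maximality every point of `T` is related to a point of `S`, so the relation classes of `S`
  -- cover `T`.
  obtain ⟨S, ⟨hST, hSR⟩, hmax⟩ := exists_max_image P Finset.card hP ⟨∅, by simp [P]⟩
  refine ⟨S, hST, hSR, ?_⟩
  refine le_trans (Finset.card_le_card fun b hb => ?_)
    (Finset.card_biUnion_le_card_mul S (fun a => T.filter fun b => R b a) N fun a ha =>
      hN a (hST ha) _ (Finset.filter_subset _ _) fun b hb => (Finset.mem_filter.1 hb).2)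
  by_contra hcon
  have hnot : ∀ a ∈ S, ¬ R b a := by
    intro a ha hR
    exact hcon (Finset.mem_biUnion.2 ⟨a, ha, Finset.mem_filter.2 ⟨hb, hR⟩⟩)
  have hbS : b ∉ S := fun h => hnot b h (hrefl b)
  have hmem : insert b S ∈ P := by
    refine ⟨Finset.insert_subset hb hST, ?_⟩
    intro x hx y hy hne
    rcases Finset.mem_insert.1 hx with rfl | hxS <;> rcases Finset.mem_insert.1 hy with rfl | hyS
    · exact absurd rfl hne
    · exact hnot y hyS
    · exact fun h => hnot x hxS (hsymm _ _ h)
    · exact hSR x hxS y hyS hne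
  have := hmax _ hmem
  rw [Finset.card_insert_of_notMem hbS] at this
  omega

/-- The families in a separated set which stay close to a given family, in the Hausdorff metric,
are determined by their itineraries along multiples of the block length `m`. -/
lemma card_close_families_le {X : Type*} [MetricSpace X] {ι : Type*} [Fintype ι] [DecidableEq ι]
    [Nonempty ι] (f : ℕ → C(X, X)) {m n : ℕ} (hm : 0 < m) {ε δ : ℝ}
    (hδ : ∀ s, ∀ t ≤ m, ∀ x y : X,
      dist (orbitMap (fun n => ⇑(f n)) s x) (orbitMap (fun n => ⇑(f n)) s y) ≤ δ →
      dist (orbitMap (fun n => ⇑(f n)) (s + t) x) (orbitMap (fun n => ⇑(f n)) (s + t) y) ≤ ε / 2)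
    {E : Finset X} (hE : IsSeparated (fun n => ⇑(f n)) n ε E) (c : ι → X) (T : Finset (ι → X))
    (hTE : ∀ d ∈ T, ∀ i, d i ∈ E)
    (hT : ∀ d ∈ T, ∀ j < n, dist (orbitMap (fun n => hyperMap (f n)) j (finiteCompacts d))
      (orbitMap (fun n => hyperMap (f n)) j (finiteCompacts c)) ≤ δ) :
    T.card ≤ (Fintype.card ι ^ (n / m + 1)) ^ Fintype.card ι := by
  set F := orbitMap fun n => ⇑(f n) with hF
  have key : ∀ d : ι → X, ∃ w : ι → Fin (n / m + 1) → ι, d ∈ T →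
      ∀ i l, l.1 * m < n → dist (F (l.1 * m) (d i)) (F (l.1 * m) (c (w i l))) ≤ δ := by
    intro d
    have : ∀ i (l : Fin (n / m + 1)), ∃ a, d ∈ T → l.1 * m < n →
        dist (F (l.1 * m) (d i)) (F (l.1 * m) (c a)) ≤ δ := by
      intro i l
      by_cases h : d ∈ T ∧ l.1 * m < n
      · have h' := hT d h.1 _ h.2
        rw [orbitMap_hyperMap_finiteCompacts, orbitMap_hyperMap_finiteCompacts] at h'
        obtain ⟨a, ha⟩ := exists_dist_le_of_dist_finiteCompacts_le h' i
        exact ⟨a, fun _ _ => ha⟩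
      -- Junk value; it is needed even for `d ∈ T` when `m` divides `n`, since the last index then
      -- gives time `n`.
      · exact ⟨Classical.arbitrary ι, fun h1 h2 => absurd ⟨h1, h2⟩ h⟩
    choose w hw using this
    exact ⟨w, fun h i l => hw i l h⟩
  choose w hw using key
  have hinj : InjOn w T := by
    intro d hd d' hd' hww
    funext i
    by_contra hne
    obtain ⟨j, hj, hsep⟩ := hE _ (hTE d hd i) _ (hTE d' hd' i) hne
    have hlm : j / m * m ≤ j := Nat.div_mul_le_self j m
    -- At the start of the block containing `j`, both entries are `δ`-close to the same entry of
    -- `c`. At time `j` they are `ε / 2`-close to it, which contradicts separation.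
    let l : Fin (n / m + 1) := ⟨j / m, Nat.lt_succ_of_le (Nat.div_le_div_right hj.le)⟩
    have hj' : j / m * m + j % m = j := Nat.div_add_mod' j m
    have h1 := hδ _ (j % m) (Nat.mod_lt j hm).le _ _ (hw d hd i l (hlm.trans_lt hj))
    have h2 := hδ _ (j % m) (Nat.mod_lt j hm).le _ _ (hw d' hd' i l (hlm.trans_lt hj))
    simp only [l, hj', ← hww] at h1 h2
    have h3 := dist_triangle_right (F j (d i)) (F j (d' i)) (F j (c (w d i l)))
    simp only [l] at h3
    rw [← hF] at hsep
    linarith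
  calc T.card ≤ (Finset.univ : Finset (ι → Fin (n / m + 1) → ι)).card :=
        Finset.card_le_card_of_injOn w (fun _ _ => Finset.mem_univ _) hinj
    _ = _ := by simp

/-- Greedy selection among all tuples from `E`, for the relation of staying `δ`-close in the
hyperspace. Tuples with the same value set are related, so the selected tuples give distinct compact
sets. -/
lemma card_pow_le_card_mul_of_isSeparated {X : Type*} [MetricSpace X] {ι : Type*} [Fintype ι]
    [Nonempty ι] (f : ℕ → C(X, X)) {m n : ℕ} (hm : 0 < m) {ε δ : ℝ} (hδ0 : 0 < δ)
    (hδ : ∀ s, ∀ t ≤ m, ∀ x y : X,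
      dist (orbitMap (fun n => ⇑(f n)) s x) (orbitMap (fun n => ⇑(f n)) s y) ≤ δ →
      dist (orbitMap (fun n => ⇑(f n)) (s + t) x) (orbitMap (fun n => ⇑(f n)) (s + t) y) ≤ ε / 2)
    {E : Finset X} (hE : IsSeparated (fun n => ⇑(f n)) n ε E) :
    ∃ N : ℕ, (N : ℕ∞) ≤ maxSep (fun n => hyperMap (f n)) n δ ∧
      E.card ^ Fintype.card ι ≤ N * (Fintype.card ι ^ (n / m + 1)) ^ Fintype.card ι := by
  classical
  let R : (ι → X) → (ι → X) → Prop := fun d c => ∀ j < n,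
    dist (orbitMap (fun n => hyperMap (f n)) j (finiteCompacts d))
      (orbitMap (fun n => hyperMap (f n)) j (finiteCompacts c)) ≤ δ
  obtain ⟨S, -, hSR, hcard⟩ := exists_pairwise_not_card_le
    (Fintype.piFinset fun _ : ι => E) R (fun c j _ => by rw [dist_self]; exact hδ0.le)
    (fun c d h j hj => by rw [dist_comm]; exact h j hj)
    ((Fintype.card ι ^ (n / m + 1)) ^ Fintype.card ι) (fun c _ B hB hR =>
      card_close_families_le f hm hδ hE c B (fun d hd => Fintype.mem_piFinset.1 (hB hd)) hR)
  refine ⟨S.card, ?_, by simpa using hcard⟩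
  have hfar : ∀ c ∈ S, ∀ d ∈ S, c ≠ d → ∃ j < n,
      δ < dist (orbitMap (fun n => hyperMap (f n)) j (finiteCompacts c))
        (orbitMap (fun n => hyperMap (f n)) j (finiteCompacts d)) := by
    intro c hc d hd hne
    simpa [R] using hSR c hc d hd hne
  have hinj : InjOn (finiteCompacts : (ι → X) → NonemptyCompacts X) (S : Set (ι → X)) := by
    intro c hc d hd hcd
    by_contra hne
    obtain ⟨j, -, hj⟩ := hfar c hc d hd hne
    rw [hcd, dist_self] at hj
    exact hj.not_gt hδ0
  rw [← encard_coe_eq_coe_finsetCard, ← hinj.encard_image]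
  apply IsSeparated.encard_le_maxSep
  rintro _ ⟨c, hc, rfl⟩ _ ⟨d, hd, rfl⟩ hne
  exact hfar c hc d hd fun h => hne (congrArg _ h)

/-! ## Growth rates -/

lemma exists_nat_le_maxSep_of_lt_log_div {Y : Type*} [MetricSpace Y] {f : ℕ → Y → Y} {n : ℕ}
    (hn : 0 < n) {ε h : ℝ}
    (hlt : (h : EReal) < ENNReal.log (maxSep f n ε : ENNReal) / (n : EReal)) :
    ∃ N : ℕ, (N : ℕ∞) ≤ maxSep f n ε ∧ Real.exp (h * n) ≤ N := by
  rw [EReal.lt_div_iff (by exact_mod_cast hn) (EReal.natCast_ne_top n)] at hlt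
  have hlog : ENNReal.log (ENNReal.ofReal (Real.exp (h * n))) = (h : EReal) * (n : EReal) := by
    rw [ENNReal.log_ofReal_of_pos (Real.exp_pos _), Real.log_exp]
    norm_cast
  rw [← hlog, ENNReal.log_lt_log_iff] at hlt
  rcases eq_or_ne (maxSep f n ε) ⊤ with htop | htop
  · exact ⟨⌈Real.exp (h * n)⌉₊, htop ▸ le_top, Nat.le_ceil _⟩
  · obtain ⟨N, hN⟩ := ENat.ne_top_iff_exists.1 htop
    refine ⟨N, hN.le, ?_⟩
    rw [← hN, ENat.toENNReal_coe, ENNReal.ofReal_lt_natCast (by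
      rintro rfl
      simp at hlt)] at hlt
    exact hlt.le

lemma le_log_div_of_exp_le {Y : Type*} [MetricSpace Y] {f : ℕ → Y → Y} {n N : ℕ}
    (hn : 0 < n) {ε h : ℝ} (hN : (N : ℕ∞) ≤ maxSep f n ε) (hexp : Real.exp (h * n) ≤ N) :
    (h : EReal) ≤ ENNReal.log (maxSep f n ε : ENNReal) / (n : EReal) := by
  rw [EReal.le_div_iff_mul_le (by exact_mod_cast hn) (EReal.natCast_ne_top n)]
  have hlog : ENNReal.log (ENNReal.ofReal (Real.exp (h * n))) = (h : EReal) * (n : EReal) := by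
    rw [ENNReal.log_ofReal_of_pos (Real.exp_pos _), Real.log_exp]
    norm_cast
  rw [← hlog, ENNReal.log_le_log_iff]
  calc ENNReal.ofReal (Real.exp (h * n)) ≤ (N : ENNReal) :=
        ENNReal.ofReal_le_of_le_toReal (by simpa using hexp)
    _ ≤ _ := by exact_mod_cast hN

/-- If an equicontinuous system has at least `exp (n * h)` separated orbits for infinitely many
`n`, then the entropy of the hyperspace system is at least `k * h / 2` for every `k`. -/
lemma mul_le_entropy_hyperMap {X : Type*} [MetricSpace X] {f : ℕ → C(X, X)}
    (hf : UniformEquicontinuous fun n => ⇑(f n)) {ε h : ℝ} (hε : 0 < ε) (hh : 0 < h)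
    (hlt : (h : EReal) < limsup (fun n : ℕ =>
      ENNReal.log (maxSep (fun n => ⇑(f n)) n ε : ENNReal) / (n : EReal)) atTop)
    {k : ℕ} (hk : 0 < k) :
    ((k * (h / 2) : ℝ) : EReal) ≤ entropy fun n => hyperMap (f n) := by
  have : Nonempty (Fin k) := ⟨⟨0, hk⟩⟩
  have hk0 : (0 : ℝ) < k := by exact_mod_cast hk
  -- For `n ≥ m` there are at most `2 n / m` blocks, so the factor 4 makes the itinerary cost per
  -- entry at most `h n / 2`, half of the available growth.
  obtain ⟨m, hm⟩ := exists_nat_gt (4 * Real.log k / h)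
  have hlogk : 0 ≤ Real.log k := Real.log_natCast_nonneg k
  have hm0 : (0 : ℝ) < m := lt_of_le_of_lt (by positivity) hm
  obtain ⟨δ, hδ0, hδ⟩ := exists_forall_dist_orbitMap_le hf m (half_pos hε)
  refine le_trans ?_ (le_iSup₂ (f := fun (ε : ℝ) (_ : 0 < ε) => limsup (fun n : ℕ =>
    ENNReal.log (maxSep (fun n => hyperMap (f n)) n ε : ENNReal) / (n : EReal)) atTop) δ hδ0)
  refine le_limsup_of_frequently_le ?_
  refine ((frequently_lt_of_lt_limsup (by isBoundedDefault) hlt).and_eventually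
    (eventually_ge_atTop m)).mono ?_
  rintro n ⟨hn, hmn⟩
  have hmpos : 0 < m := by exact_mod_cast hm0
  have hnpos : 0 < n := by omega
  obtain ⟨M, hM, hexpM⟩ := exists_nat_le_maxSep_of_lt_log_div hnpos hn
  obtain ⟨E, hE, rfl⟩ := exists_finset_isSeparated hM
  obtain ⟨N, hN, hcard⟩ := card_pow_le_card_mul_of_isSeparated (ι := Fin k) f hmpos hδ0 hδ hE
  refine le_log_div_of_exp_le hnpos hN ?_
  rw [Fintype.card_fin] at hcard
  have hq : ((n / m + 1 : ℕ) : ℝ) * Real.log k ≤ h / 2 * n := by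
    have h1 : ((n / m + 1 : ℕ) : ℝ) * m ≤ 2 * n := by
      have := Nat.div_mul_le_self n m
      have h2 : (n / m + 1) * m ≤ 2 * n := by
        rw [add_mul]
        omega
      exact_mod_cast h2
    have h3 : Real.log k ≤ h / 4 * m := by
      rw [div_lt_iff₀ hh] at hm
      linarith
    calc ((n / m + 1 : ℕ) : ℝ) * Real.log k ≤ ((n / m + 1 : ℕ) : ℝ) * (h / 4 * m) := by gcongr
      _ = h / 4 * (((n / m + 1 : ℕ) : ℝ) * m) := by ring
      _ ≤ h / 4 * (2 * n) := by gcongr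
      _ = h / 2 * n := by ring
  have hpow : ((k : ℝ) ^ (n / m + 1)) ^ k ≤ Real.exp (k * (h / 2) * n) := by
    have h1 : (k : ℝ) ^ (n / m + 1) ≤ Real.exp (h / 2 * n) := by
      rw [← Real.log_le_iff_le_exp (by positivity), Real.log_pow]
      exact hq
    calc ((k : ℝ) ^ (n / m + 1)) ^ k ≤ Real.exp (h / 2 * n) ^ k := by gcongr
      _ = Real.exp (k * (h / 2) * n) := by rw [← Real.exp_nat_mul]; ring_nf
  refine le_of_mul_le_mul_right ?_ (Real.exp_pos (k * (h / 2) * n))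
  calc Real.exp (k * (h / 2) * n) * Real.exp (k * (h / 2) * n) = Real.exp (h * n) ^ k := by
        rw [← Real.exp_add, ← Real.exp_nat_mul]; ring_nf
    _ ≤ (E.card : ℝ) ^ k := by gcongr
    _ ≤ N * ((k : ℝ) ^ (n / m + 1)) ^ k := by exact_mod_cast hcard
    _ ≤ N * Real.exp (k * (h / 2) * n) := by gcongr

lemma entropy_hyperMap_eq_top {X : Type*} [MetricSpace X] {f : ℕ → C(X, X)}
    (hf : UniformEquicontinuous fun n => ⇑(f n)) (hpos : 0 < entropy fun n => ⇑(f n)) :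
    entropy (fun n => hyperMap (f n)) = ⊤ := by
  simp only [entropy, lt_iSup_iff] at hpos
  obtain ⟨ε, hε, hlim⟩ := hpos
  obtain ⟨h, hh, hlt⟩ := EReal.lt_iff_exists_real_btwn.1 hlim
  have hh0 : 0 < h := by exact_mod_cast hh
  refine EReal.eq_top_iff_forall_lt _ |>.2 fun y => ?_
  -- The maximum with 0 forces `k > 0`, so that tuples have nonempty value sets.
  obtain ⟨k, hk⟩ := exists_nat_gt (max (y / (h / 2)) 0)
  obtain ⟨hk1, hk2⟩ := max_lt_iff.1 hk
  refine lt_of_lt_of_le ?_ (mul_le_entropy_hyperMap hf hε hh0 hlt (by exact_mod_cast hk2))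
  rw [div_lt_iff₀ (by positivity)] at hk1
  exact_mod_cast hk1

end NDS

end

theorem mainTheorem1 {X : Type*} [MetricSpace X] [CompactSpace X] (f : ℕ → C(X, X))
    (hf : Equicontinuous (fun n => ⇑(f n)))
    (hpos : 0 < NDS.entropy (fun n => ⇑(f n))) :
    NDS.entropy (fun n => NDS.hyperMap (f n)) = ⊤ ∧
      NDS.entropy (fun n => NDS.fuzzyMap (f n)) = ⊤ := by
  -- Compactness of `X` enters the hyperspace part only here, to make the equicontinuity uniform.
  have hK := NDS.entropy_hyperMap_eq_top (CompactSpace.uniformEquicontinuous_of_equicontinuous hf) hpos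
  exact ⟨hK, top_le_iff.1 (hK ▸ NDS.entropy_hyperMap_le_entropy_fuzzyMap f)⟩
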